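/- Let $d\ge 1$ and let $\Lambda$ be a quantum channel on a $d$-dimensional system, i.e. a completely positive trace-preserving linear map from the complex $d\times d$ matrices to themselves. Let $r=1-F_{\rm avg}(\Lambda)$ be its average infidelity, where $$F_{\rm avg}(\Lambda)=\int \mathrm{Tr}\bigl[\psi\,\Lambda(\psi)\bigr]\,\mathrm{d}\psi$$ is the average over all pure states $\psi=|\psi\rangle\langle\psi|$ on $\mathbb{C}^d$ with respect to the unitarily invariant probability measure. For a Hermiticity-preserving linear map $\Delta$ on the $d\times d$ matrices let $$\|\Delta\|_\diamond=\sup_\psi\bigl\|(\mathbb{1}_d\otimes\Delta)(\psi)\bigr\|_1,\qquad \|X\|_1=\mathrm{Tr}\sqrt{X^\dagger X},$$ be its diamond norm, the supremum being over all pure states $\psi$ on $\mathbb{C}^d\otimes\mathbb{C}^d$. Then, with $\mathbb{1}$ the identity channel, $$\frac{r(d+1)}{d}\;\le\;\tfrac12\,\|\Lambda-\mathbb{1}\|_\diamond\;\le\;\sqrt{d(d+1)\,r}.$$ -/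

import Mathlib

open scoped Matrix ComplexOrder MatrixOrder CStarAlgebra Matrix.Norms.L2Operator
open MeasureTheory

noncomputable section

namespace QuantumChannel

/-- The rank-one projector `|ψ⟩⟨ψ|` of a vector `ψ` of `ℂ^ι` (a pure state if `ψ` has norm one). -/
def pureState {ι : Type*} (ψ : EuclideanSpace ℂ ι) : Matrix ι ι ℂ :=
  Matrix.vecMulVec ψ (star (ψ : ι → ℂ))

/-- The trace norm `‖X‖₁ = Tr √(X† X)`. -/
def traceNorm {ι : Type*} [Fintype ι] [DecidableEq ι] (X : Matrix ι ι ℂ) : ℝ :=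
  (CFC.sqrt (Xᴴ * X)).trace.re

/-- The map `1_d ⊗ Δ` on operators on `ℂ^d ⊗ ℂ^d`: a `d × d` block matrix with blocks in
`Matrix (Fin d) (Fin d) ℂ` is sent to the block matrix obtained by applying `Δ` to each block.
The first index in `Fin d × Fin d` labels the block (the reference system). -/
def idTensor {d : ℕ} (Δ : Matrix (Fin d) (Fin d) ℂ →ₗ[ℂ] Matrix (Fin d) (Fin d) ℂ)
    (M : Matrix (Fin d × Fin d) (Fin d × Fin d) ℂ) :
    Matrix (Fin d × Fin d) (Fin d × Fin d) ℂ :=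
  Matrix.of fun p q ↦ Δ (Matrix.of fun i j ↦ M (p.1, i) (q.1, j)) p.2 q.2

/-- The diamond norm `‖Δ‖_⋄ = sup_ψ ‖(1_d ⊗ Δ)(|ψ⟩⟨ψ|)‖₁` of a Hermiticity-preserving map `Δ`,
the supremum being over all unit vectors `ψ` of `ℂ^d ⊗ ℂ^d`. -/
def diamondNorm {d : ℕ} (Δ : Matrix (Fin d) (Fin d) ℂ →ₗ[ℂ] Matrix (Fin d) (Fin d) ℂ) : ℝ :=
  ⨆ ψ : Metric.sphere (0 : EuclideanSpace ℂ (Fin d × Fin d)) 1,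
    traceNorm (idTensor Δ (pureState ψ.1))

/-- The average gate fidelity `F_avg(Λ) = ∫ Tr[ψ Λ(ψ)] dψ` with the identity, where `dψ` is the
uniform (unitarily invariant) probability measure on the unit vectors of `ℂ^d`: the average is taken
over the surface measure of the unit sphere, normalized to total mass one. -/
def avgFidelity {d : ℕ} (Λ : Matrix (Fin d) (Fin d) ℂ →ₗ[ℂ] Matrix (Fin d) (Fin d) ℂ) : ℝ :=
  ⨍ ψ : Metric.sphere (0 : EuclideanSpace ℂ (Fin d)) 1,
    (pureState ψ.1 * Λ (pureState ψ.1)).trace.re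
      ∂((volume : Measure (EuclideanSpace ℂ (Fin d))).toSphere)

end QuantumChannel

end

/-! Everything depends on one number, the overlap `G = ⟨Ω|J|Ω⟩` of the Choi matrix `J` of `Λ` with
the unnormalized maximally entangled vector `Ω`. The bidegree-(2,2) moments of the sphere
(`moment_eq`) give `F_avg = (d + G) / (d (d + 1))`, so `r (d + 1) / d = 1 - G / d²` and `d (d + 1) r
= d² - G`.

Lower bound: on the maximally entangled input, the effect complementary to that state already
detects `1 - G / d²`.

Upper bound: factor `J = M M†` and `|Ω⟩⟨Ω| = N N†` with `Tr (M N†) = s = √G`. For every `t > 0` an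
operator of trace `t (d - s) + (d + s) / t` dominates `±(M M† - N N†)` (`posSemidef_meanBound_add`,
`posSemidef_meanBound_sub`). A pure input conjugates the Choi matrix by `A ⊗ 1`, where `A` has
Hilbert–Schmidt norm one, and this does not increase the trace of a positive operator. Optimizing
over `t` gives `2 √(d² - s²)`. -/

noncomputable section

namespace QuantumChannel

/-! ### Unitary invariance of the mean over the sphere. -/

/-- The self-map of the unit sphere induced by a linear isometric equivalence. -/
def sphereMap {E : Type*} [NormedAddCommGroup E] [InnerProductSpace ℝ E] (U : E ≃ₗᵢ[ℝ] E)
    (x : Metric.sphere (0 : E) 1) : Metric.sphere (0 : E) 1 :=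
  ⟨U x.1, by simp⟩

lemma continuous_sphereMap {E : Type*} [NormedAddCommGroup E] [InnerProductSpace ℝ E]
    (U : E ≃ₗᵢ[ℝ] E) : Continuous (sphereMap U) :=
  (U.continuous.comp continuous_subtype_val).subtype_mk _

open scoped Pointwise in
-- The surface measure of a set is a multiple of the volume of the cone over it; a linear isometry
-- commutes with forming cones and preserves volume.
lemma measurePreserving_sphereMap {E : Type*} [NormedAddCommGroup E] [InnerProductSpace ℝ E]
    [FiniteDimensional ℝ E] [MeasurableSpace E] [BorelSpace E] (U : E ≃ₗᵢ[ℝ] E) :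
    MeasurePreserving (sphereMap U) (volume : Measure E).toSphere
      (volume : Measure E).toSphere := by
  have hm : Measurable (sphereMap U) := (continuous_sphereMap U).measurable
  refine ⟨hm, ?_⟩
  ext s hs
  rw [Measure.map_apply hm hs, Measure.toSphere_apply' _ (hm hs), Measure.toSphere_apply' _ hs]
  congr 1
  have h : Set.Ioo (0 : ℝ) 1 • (Subtype.val '' (sphereMap U ⁻¹' s)) =
      U ⁻¹' (Set.Ioo (0 : ℝ) 1 • (Subtype.val '' s)) := by
    ext x
    simp only [Set.mem_smul, Set.mem_preimage, Set.mem_image]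
    constructor
    · rintro ⟨t, ht, _, ⟨y, hy, rfl⟩, rfl⟩
      exact ⟨t, ht, _, ⟨_, hy, rfl⟩, by simp [sphereMap]⟩
    · rintro ⟨t, ht, _, ⟨y, hy, rfl⟩, hx⟩
      refine ⟨t, ht, _, ⟨sphereMap U.symm y, ?_, rfl⟩, ?_⟩
      · convert hy
        ext1
        simp [sphereMap]
      · apply U.injective
        rw [← hx]
        simp [sphereMap]
  rw [h]
  exact U.measurePreserving.measure_preimage_equiv (f := U.toMeasurableEquiv) _

/-- The unit sphere of `ℂ^d`. -/
abbrev Sphere (d : ℕ) := Metric.sphere (0 : EuclideanSpace ℂ (Fin d)) 1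

/-- The mean of a continuous function on the unit sphere of `ℂ^d`, as a linear functional. -/
def sphereMean (d : ℕ) : C(Sphere d, ℂ) →ₗ[ℂ] ℂ where
  toFun f := ⨍ ψ, f ψ ∂((volume : Measure (EuclideanSpace ℂ (Fin d))).toSphere)
  map_add' f g := by
    simp only [average_eq, ContinuousMap.add_apply]
    rw [integral_add, smul_add]
    · exact f.continuous.integrable_of_hasCompactSupport (.of_compactSpace _)
    · exact g.continuous.integrable_of_hasCompactSupport (.of_compactSpace _)
  map_smul' c f := by
    simp only [average_eq, ContinuousMap.smul_apply, RingHom.id_apply]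
    rw [integral_smul, smul_comm]

lemma sphereMean_apply {d : ℕ} (f : C(Sphere d, ℂ)) :
    sphereMean d f = ⨍ ψ, f ψ ∂((volume : Measure (EuclideanSpace ℂ (Fin d))).toSphere) := rfl

lemma sphereMean_one {d : ℕ} (hd : 1 ≤ d) : sphereMean d 1 = 1 := by
  have : Nonempty (Fin d) := ⟨⟨0, hd⟩⟩
  have : NeZero ((volume : Measure (EuclideanSpace ℂ (Fin d))).toSphere) :=
    ⟨Measure.toSphere_ne_zero _⟩
  rw [sphereMean_apply]
  simp only [ContinuousMap.one_apply]
  exact average_const _ _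

lemma sphereMean_eq_of_forall_map {d : ℕ}
    (U : EuclideanSpace ℂ (Fin d) ≃ₗᵢ[ℂ] EuclideanSpace ℂ (Fin d)) {f g : C(Sphere d, ℂ)}
    (h : ∀ ψ χ : Sphere d, χ.1 = U ψ.1 → f χ = g ψ) : sphereMean d f = sphereMean d g := by
  let V : EuclideanSpace ℂ (Fin d) ≃ₗᵢ[ℝ] EuclideanSpace ℂ (Fin d) :=
    { U.toLinearEquiv.restrictScalars ℝ with norm_map' := U.norm_map }
  rw [sphereMean_apply, sphereMean_apply, average_eq, average_eq]
  congr 1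
  have hV := measurePreserving_sphereMap V
  have hg : ∀ ψ, g ψ = f (sphereMap V ψ) := fun ψ ↦ (h ψ _ rfl).symm
  simp only [hg]
  rw [← hV.map_eq, integral_map hV.measurable.aemeasurable
    f.continuous.aestronglyMeasurable, hV.map_eq]

/-! ### Fourth-order moments of the coordinates. -/

/-- The coordinate functions on the unit sphere. -/
def coord {d : ℕ} (i : Fin d) : C(Sphere d, ℂ) := ⟨fun ψ ↦ ψ.1 i, by fun_prop⟩

@[simp] lemma coord_apply {d : ℕ} (i : Fin d) (ψ : Sphere d) : coord i ψ = ψ.1 i := rfl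

/-- The moments of bidegree `(2, 2)` of the uniform measure on the sphere. -/
def moment {d : ℕ} (i j k l : Fin d) : ℂ :=
  sphereMean d (coord i * star (coord j) * coord k * star (coord l))

lemma moment_def {d : ℕ} (i j k l : Fin d) : sphereMean d
    (coord i * star (coord j) * coord k * star (coord l)) = moment i j k l := rfl

lemma moment_comm_left {d : ℕ} (i j k l : Fin d) : moment i j k l = moment k j i l := by
  unfold moment; congr 1; ring

lemma moment_comm_right {d : ℕ} (i j k l : Fin d) : moment i j k l = moment i l k j := by
  unfold moment; congr 1; ring

/-- Multiplication of one coordinate by a phase. -/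
def phaseEquiv {d : ℕ} (m : Fin d) :
    EuclideanSpace ℂ (Fin d) ≃ₗᵢ[ℂ] EuclideanSpace ℂ (Fin d) :=
  LinearIsometryEquiv.piLpCongrRight 2 fun i ↦
    if i = m then LinearIsometryEquiv.ofSurjective
      { toLinearMap := Complex.I • LinearMap.id, norm_map' := fun x ↦ by simp }
      (fun x ↦ ⟨-Complex.I * x, by simp [← mul_assoc]⟩)
    else LinearIsometryEquiv.refl ℂ ℂ

lemma phaseEquiv_apply {d : ℕ} (m : Fin d) (ψ : EuclideanSpace ℂ (Fin d)) (i : Fin d) :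
    phaseEquiv m ψ i = (if i = m then Complex.I else 1) * ψ i := by
  unfold phaseEquiv
  by_cases h : i = m
  · simp only [LinearIsometryEquiv.piLpCongrRight_apply, h, if_true]
    rfl
  · simp [h]

lemma moment_phase {d : ℕ} (m i j k l : Fin d) :
    moment i j k l = (if i = m then Complex.I else 1) * (if j = m then -Complex.I else 1) *
      (if k = m then Complex.I else 1) * (if l = m then -Complex.I else 1) * moment i j k l := by
  conv_rhs => rw [moment, ← smul_eq_mul, ← map_smul]
  refine sphereMean_eq_of_forall_map (phaseEquiv m) fun ψ χ h ↦ ?_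
  have hc (j : Fin d) : star (if j = m then Complex.I else 1) =
      (if j = m then -Complex.I else 1) := by split_ifs <;> simp
  simp only [ContinuousMap.mul_apply, ContinuousMap.smul_apply, ContinuousMap.star_apply,
    coord_apply, h, phaseEquiv_apply, star_mul', smul_eq_mul, hc]
  ring

/-- An unmatched coordinate `i` contributes a phase `I`, or `-1` if it occurs twice, so invariance
forces the moment to vanish. -/
lemma moment_eq_zero_of_ne {d : ℕ} {i j k l : Fin d} (h₁ : i ≠ j) (h₂ : i ≠ l) :
    moment i j k l = 0 := by
  have h := moment_phase i i j k l
  simp only [if_true, h₁.symm, h₂.symm, if_false] at h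
  by_cases hk : k = i
  · simp only [hk, if_true, mul_one, Complex.I_mul_I] at h ⊢
    linear_combination (1 / 2 : ℂ) * h
  · simp only [hk, if_false, mul_one] at h
    have h' : (1 - Complex.I) * moment i j k l = 0 := by linear_combination h
    refine (mul_eq_zero.1 h').resolve_left fun h0 ↦ ?_
    have := congrArg Complex.re h0
    simp at this

lemma moment_diag_eq_zero {d : ℕ} {i k l : Fin d} (h : k ≠ l) : moment i i k l = 0 := by
  rw [moment_comm_left]
  by_cases hki : k = i
  · subst hki
    have hp := moment_phase l k k k l
    simp only [if_true, h, if_false, mul_one, one_mul] at hp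
    have h' : (1 + Complex.I) * moment k k k l = 0 := by linear_combination hp
    refine (mul_eq_zero.1 h').resolve_left fun h0 ↦ ?_
    have := congrArg Complex.re h0
    simp at this
  · exact moment_eq_zero_of_ne hki h

/-- The reflection along `2 e_k + e_i`, a rational rotation mixing two coordinates. -/
def rotEquiv {d : ℕ} (i k : Fin d) :
    EuclideanSpace ℂ (Fin d) ≃ₗᵢ[ℂ] EuclideanSpace ℂ (Fin d) :=
  (ℂ ∙ (EuclideanSpace.single i (1 : ℂ) + (2 : ℂ) • EuclideanSpace.single k (1 : ℂ))).reflection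

lemma rotEquiv_apply {d : ℕ} {i k : Fin d} (h : i ≠ k) (ψ : EuclideanSpace ℂ (Fin d)) :
    rotEquiv i k ψ i = (-3 * ψ i + 4 * ψ k) / 5 := by
  have hn : ‖EuclideanSpace.single i (1 : ℂ) + (2 : ℂ) • EuclideanSpace.single k (1 : ℂ)‖ ^ 2
      = (5 : ℝ) := by
    have h0 : inner ℂ (EuclideanSpace.single i (1 : ℂ)) (EuclideanSpace.single k (1 : ℂ)) = 0 := by
      simp [EuclideanSpace.inner_single_left, h]
    rw [norm_add_sq (𝕜 := ℂ), inner_smul_right, h0]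
    simp [norm_smul]
    norm_num
  rw [rotEquiv, Submodule.reflection_singleton_apply]
  rw [← RCLike.ofReal_pow, hn]
  simp [inner_add_left, inner_smul_left, h, EuclideanSpace.inner_single_left,
    Complex.conj_ofNat]
  ring

/-- Phases alone cannot relate `moment i i i i` to `moment i i k k`. This comes from expanding `|(-3
x + 4 y) / 5|⁴`: the phase-dependent terms average to zero, and `576 = 2 · 9 · 16 + 2 · 12²`. -/
lemma moment_rot {d : ℕ} {i k : Fin d} (h : i ≠ k) :
    625 * moment i i i i = 81 * moment i i i i + 576 * moment i i k k + 256 * moment k k k k := by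
  have key : moment i i i i = sphereMean d ((1 / 625 : ℂ) •
      ((81 : ℂ) • (coord i * star (coord i) * coord i * star (coord i))
      + (576 : ℂ) • (coord i * star (coord i) * coord k * star (coord k))
      + (256 : ℂ) • (coord k * star (coord k) * coord k * star (coord k))
      - (216 : ℂ) • (coord i * star (coord i) * coord i * star (coord k))
      - (216 : ℂ) • (coord k * star (coord i) * coord i * star (coord i))
      + (144 : ℂ) • (coord i * star (coord k) * coord i * star (coord k))
      + (144 : ℂ) • (coord k * star (coord i) * coord k * star (coord i))
      - (384 : ℂ) • (coord k * star (coord k) * coord k * star (coord i))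
      - (384 : ℂ) • (coord i * star (coord k) * coord k * star (coord k)))) := by
    refine sphereMean_eq_of_forall_map (rotEquiv i k) fun ψ χ hχ ↦ ?_
    simp only [ContinuousMap.mul_apply, ContinuousMap.smul_apply, ContinuousMap.star_apply,
      ContinuousMap.add_apply, ContinuousMap.sub_apply, coord_apply, hχ, rotEquiv_apply h,
      star_div₀, star_add, star_mul', star_neg, star_ofNat, smul_eq_mul]
    ring
  simp only [map_smul, map_add, map_sub, moment_def] at key
  rw [moment_diag_eq_zero (i := i) h, moment_comm_left k i i i, moment_comm_right i i k i,
    moment_diag_eq_zero (i := i) h.symm, moment_diag_eq_zero (i := k) h.symm,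
    moment_comm_left i k k k, moment_comm_right k k i k, moment_diag_eq_zero (i := k) h,
    moment_eq_zero_of_ne h h, moment_eq_zero_of_ne h.symm h.symm] at key
  simp only [smul_eq_mul] at key
  linear_combination 625 * key

lemma sum_coord {d : ℕ} : ∑ i : Fin d, coord i * star (coord i) = 1 := by
  ext ψ
  have h : ‖ψ.1‖ ^ 2 = 1 := by simp
  rw [EuclideanSpace.norm_sq_eq] at h
  simp only [ContinuousMap.sum_apply, ContinuousMap.mul_apply, ContinuousMap.star_apply,
    coord_apply, ContinuousMap.one_apply, RCLike.star_def, Complex.mul_conj']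
  exact_mod_cast h

lemma sum_moment {d : ℕ} (hd : 1 ≤ d) : ∑ i : Fin d, ∑ k : Fin d, moment i i k k = 1 := by
  rw [← sphereMean_one hd]
  conv_rhs => rw [← one_mul 1, ← sum_coord, Finset.sum_mul_sum]
  simp only [map_sum, moment, mul_assoc]

lemma moment_eq {d : ℕ} (i j k l : Fin d) :
    moment i j k l = ((if i = j then 1 else 0) * (if k = l then 1 else 0) +
      (if i = l then 1 else 0) * (if k = j then 1 else 0)) / (d * (d + 1)) := by
  have hd : 1 ≤ d := i.pos
  have hα (a b : Fin d) : moment a a a a = moment b b b b := by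
    by_cases h : a = b
    · rw [h]
    · have h1 := moment_rot h
      have h2 := moment_rot (Ne.symm h)
      rw [moment_comm_left b b a a, moment_comm_right a b b a] at h2
      -- Both orders of the pair share the same mixed moment; subtracting leaves `(544 + 256)` times
      -- the difference of the fourth moments.
      linear_combination (1 / 800 : ℂ) * (h1 - h2)
  obtain ⟨c, hc⟩ : ∃ c, moment i i i i = 2 * c := ⟨moment i i i i / 2, by ring⟩
  have hβ (a b : Fin d) : moment a a b b =
      (1 + if a = b then 1 else 0) * c := by
    split_ifs with h
    · subst h
      rw [hα a i, hc]; ring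
    · have h1 := moment_rot h
      rw [hα b i, hα a i, hc] at h1
      linear_combination (-1 / 576 : ℂ) * h1
  have hd0 : (d : ℂ) ≠ 0 := by exact_mod_cast (by omega : d ≠ 0)
  have hd1 : (d + 1 : ℂ) ≠ 0 := by exact_mod_cast (by omega : d + 1 ≠ 0)
  have hs := sum_moment hd
  simp only [hβ, ← Finset.sum_mul, Finset.sum_add_distrib, Finset.sum_ite_eq, Finset.mem_univ,
    if_true, Finset.sum_const, Finset.card_univ, Fintype.card_fin, nsmul_eq_mul, mul_one] at hs
  have hval : c = 1 / (d * (d + 1)) := by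
    field_simp
    linear_combination hs
  by_cases h1 : i = j
  · subst h1
    by_cases h2 : k = l
    · subst h2
      rw [hβ, hval]
      by_cases h3 : i = k
      · simp only [h3, if_true]; ring
      · simp [h3]
    · rw [moment_diag_eq_zero h2]
      by_cases h3 : i = l
      · simp [← h3, show k ≠ i from fun h ↦ h2 (h.trans h3)]
      · simp [h2, h3]
  · by_cases h2 : i = l
    · subst h2
      rw [moment_comm_right]
      by_cases h3 : k = j
      · subst h3
        rw [hβ, hval]
        simp [h1]
      · rw [moment_diag_eq_zero h3]
        simp [h1, h3]
    · rw [moment_eq_zero_of_ne h1 h2]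
      simp [h1, h2]

/-- The mean fidelity in terms of the matrix entries of the channel. -/
lemma avgFidelity_eq {d : ℕ} (Λ : Matrix (Fin d) (Fin d) ℂ →ₗ[ℂ] Matrix (Fin d) (Fin d) ℂ) :
    avgFidelity Λ = ((∑ i, (Λ (Matrix.single i i 1)).trace +
      ∑ i, ∑ j, Λ (Matrix.single i j 1) i j) / (d * (d + 1))).re := by
  have h (ψ : Sphere d) : (pureState ψ.1 * Λ (pureState ψ.1)).trace =
      (∑ i, ∑ j, ∑ a, ∑ b, Λ (Matrix.single i j 1) b a •
        (coord i * star (coord j) * coord a * star (coord b))) ψ := by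
    have h1 : pureState ψ.1 = ∑ i, ∑ j, (ψ.1 i * star (ψ.1 j)) • Matrix.single i j (1 : ℂ) := by
      conv_lhs => rw [Matrix.matrix_eq_sum_single (pureState ψ.1)]
      simp [pureState, Matrix.vecMulVec_apply, Matrix.smul_single]
    conv_lhs => enter [1, 2]; rw [h1, map_sum]
    simp only [map_sum, map_smul, Matrix.mul_sum, Matrix.trace_sum, Matrix.mul_smul,
      Matrix.trace_smul, ContinuousMap.sum_apply, ContinuousMap.smul_apply,
      ContinuousMap.mul_apply, ContinuousMap.star_apply, coord_apply]
    refine Finset.sum_congr rfl fun i _ ↦ Finset.sum_congr rfl fun j _ ↦ ?_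
    simp only [Matrix.trace, Matrix.diag_apply, Matrix.mul_apply, pureState,
      Matrix.vecMulVec_apply, smul_eq_mul, Pi.star_apply, Finset.mul_sum]
    refine Finset.sum_congr rfl fun a _ ↦ Finset.sum_congr rfl fun b _ ↦ ?_
    ring
  have h2 : avgFidelity Λ = (sphereMean d (∑ i, ∑ j, ∑ a, ∑ b, Λ (Matrix.single i j 1) b a •
        (coord i * star (coord j) * coord a * star (coord b)))).re := by
    rw [sphereMean_apply, avgFidelity]
    simp only [h]
    rw [average_eq, average_eq, Complex.smul_re, ← RCLike.re_eq_complex_re, ← integral_re]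
    exact (ContinuousMap.continuous _).integrable_of_hasCompactSupport (.of_compactSpace _)
  rw [h2]
  congr 1
  simp only [map_sum, map_smul, moment_def, moment_eq, smul_eq_mul, mul_add, add_div,
    Finset.sum_add_distrib, mul_div_assoc', ← Finset.sum_div]
  -- The two pairings of indices give the trace term and the overlap term.
  congr 2
  · simp [Matrix.trace]
  · simp

/-! ### Variational bounds for the trace norm. -/

section TraceNorm

variable {ι : Type*} [Fintype ι] [DecidableEq ι]

lemma traceNorm_eq_sum_abs_eigenvalues {X : Matrix ι ι ℂ} (hX : X.IsHermitian) :
    traceNorm X = ∑ i, |hX.eigenvalues i| := by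
  have h : CFC.sqrt (Xᴴ * X) = hX.cfc (fun x ↦ ‖x‖) := by
    rw [← hX.cfc_eq]
    exact CFC.abs_eq_cfc_norm X hX
  rw [traceNorm, h, Matrix.IsHermitian.cfc, Unitary.conjStarAlgAut_apply, Matrix.trace_mul_cycle]
  simp [Matrix.trace]

/-- The trace norm of a Hermitian `X` is at most `Tr W` as soon as `-W ≤ X ≤ W`. -/
lemma traceNorm_le_trace {X W : Matrix ι ι ℂ} (hX : X.IsHermitian)
    (h₁ : (W - X).PosSemidef) (h₂ : (W + X).PosSemidef) : traceNorm X ≤ W.trace.re := by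
  set U : Matrix ι ι ℂ := (hX.eigenvectorUnitary : Matrix ι ι ℂ) with hU
  have hUU : U * Uᴴ = 1 := Unitary.coe_mul_star_self _
  have hD : Uᴴ * X * U = Matrix.diagonal (fun i ↦ (hX.eigenvalues i : ℂ)) := by
    have h := hX.conjStarAlgAut_star_eigenvectorUnitary
    rw [Unitary.conjStarAlgAut_apply] at h
    simpa [hU, Matrix.star_eq_conjTranspose, Function.comp_def] using h
  have htr : W.trace = ∑ i, (Uᴴ * W * U) i i := by
    change W.trace = (Uᴴ * W * U).trace
    rw [Matrix.trace_mul_cycle, hUU, Matrix.one_mul]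
  rw [traceNorm_eq_sum_abs_eigenvalues hX, htr, Complex.re_sum]
  -- In an eigenbasis of `X`, each diagonal entry of `W` dominates the absolute value of the
  -- corresponding eigenvalue.
  refine Finset.sum_le_sum fun i _ ↦ abs_le.2 ⟨?_, ?_⟩
  · have h := (h₂.conjTranspose_mul_mul_same U).diag_nonneg (i := i)
    rw [Matrix.mul_add, Matrix.add_mul, hD] at h
    have := (Complex.le_def.1 h).1
    simp at this
    linarith
  · have h := (h₁.conjTranspose_mul_mul_same U).diag_nonneg (i := i)
    rw [Matrix.mul_sub, Matrix.sub_mul, hD] at h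
    have := (Complex.le_def.1 h).1
    simp at this
    linarith

lemma re_trace_mul_nonneg {P Q : Matrix ι ι ℂ} (hP : P.PosSemidef) (hQ : Q.PosSemidef) :
    0 ≤ (P * Q).trace.re := by
  obtain ⟨B, rfl⟩ := CStarAlgebra.nonneg_iff_eq_star_mul_self.1 hP.nonneg
  rw [Matrix.mul_assoc, Matrix.trace_mul_comm]
  exact (Complex.le_def.1 (hQ.mul_mul_conjTranspose_same B).trace_nonneg).1

/-- An effect `0 ≤ P ≤ 1` tests a traceless Hermitian `X` by at most half of its trace norm. -/
lemma two_mul_re_trace_mul_le {X P : Matrix ι ι ℂ} (hX : X.IsHermitian) (htr : X.trace = 0)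
    (hP : P.PosSemidef) (hP1 : (1 - P).PosSemidef) : 2 * (P * X).trace.re ≤ traceNorm X := by
  have hs : IsSelfAdjoint X := hX
  set Y := CFC.sqrt (Xᴴ * X) with hY
  have hYa : Y = CFC.abs X := rfl
  have h1 : (Y - X).PosSemidef := by
    rw [← Matrix.nonneg_iff_posSemidef, hYa, CFC.abs_sub_self X hs]
    exact nsmul_nonneg (CFC.negPart_nonneg X) 2
  have h2 : (Y + X).PosSemidef := by
    rw [← Matrix.nonneg_iff_posSemidef, hYa, CFC.abs_add_self X hs]
    exact nsmul_nonneg (CFC.posPart_nonneg X) 2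
  -- The sum of `Tr P(|X| - X) ≥ 0` and `Tr (1 - P)(|X| + X) ≥ 0` is `Tr |X| + Tr X - 2 Tr P X ≥ 0`.
  have e1 := re_trace_mul_nonneg hP h1
  have e2 := re_trace_mul_nonneg hP1 h2
  simp only [Matrix.mul_sub, Matrix.sub_mul, Matrix.mul_add, Matrix.one_mul, Matrix.trace_sub,
    Matrix.trace_add, htr, Complex.sub_re, Complex.add_re, Complex.zero_re] at e1 e2
  rw [traceNorm, ← hY]
  linarith

end TraceNorm

/-! ### An operator arithmetic–geometric mean inequality. -/

section MeanBound

variable {ι κ : Type*} [Fintype ι] [Fintype κ]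

lemma re_trace_mul_conjTranspose (X : Matrix ι κ ℂ) :
    (X * Xᴴ).trace.re = ∑ i, ∑ j, ‖X i j‖ ^ 2 := by
  simp [Matrix.trace, Matrix.mul_apply, Complex.mul_conj, Complex.normSq_eq_norm_sq]
  norm_cast

/-- The operator dominating both `N N† - M M†` and its negative, by the inequality between the
arithmetic and the geometric mean. -/
def meanBound (M N : Matrix ι κ ℂ) (t : ℝ) : Matrix ι ι ℂ :=
  ((t / 2 : ℝ) : ℂ) • ((N - M) * (N - M)ᴴ) + ((t⁻¹ / 2 : ℝ) : ℂ) • ((N + M) * (N + M)ᴴ)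

lemma posSemidef_meanBound (M N : Matrix ι κ ℂ) {t : ℝ} (ht : 0 < t) :
    (meanBound M N t).PosSemidef :=
  ((Matrix.posSemidef_self_mul_conjTranspose _).smul (by exact_mod_cast (by positivity))).add
    ((Matrix.posSemidef_self_mul_conjTranspose _).smul (by exact_mod_cast (by positivity)))

/-- With `S = N + M` and `D = N - M` one has `N N† - M M† = (S D† + D S†) / 2`, which completes the
square to `(S - t D)(S - t D)† / (2 t)`. The opposite sign gives `S + t D`. -/
lemma posSemidef_meanBound_add (M N : Matrix ι κ ℂ) {t : ℝ} (ht : 0 < t) :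
    (meanBound M N t + (M * Mᴴ - N * Nᴴ)).PosSemidef := by
  have h : meanBound M N t + (M * Mᴴ - N * Nᴴ) = ((t⁻¹ / 2 : ℝ) : ℂ) •
      (((N + M) - (t : ℂ) • (N - M)) * ((N + M) - (t : ℂ) • (N - M))ᴴ) := by
    have h0 : (t : ℂ) ≠ 0 := by exact_mod_cast ht.ne'
    ext i j
    simp only [meanBound, Matrix.conjTranspose_sub, Matrix.conjTranspose_add,
      Matrix.conjTranspose_smul, Matrix.mul_add, Matrix.add_mul, Matrix.mul_sub, Matrix.sub_mul,
      Matrix.smul_mul, Matrix.mul_smul, Matrix.add_apply, Matrix.sub_apply, Matrix.smul_apply,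
      smul_eq_mul, RCLike.star_def, Complex.conj_ofReal]
    push_cast
    field_simp
    ring
  rw [h]
  exact (Matrix.posSemidef_self_mul_conjTranspose _).smul (by exact_mod_cast (by positivity))

lemma posSemidef_meanBound_sub (M N : Matrix ι κ ℂ) {t : ℝ} (ht : 0 < t) :
    (meanBound M N t - (M * Mᴴ - N * Nᴴ)).PosSemidef := by
  have h : meanBound M N t - (M * Mᴴ - N * Nᴴ) = ((t⁻¹ / 2 : ℝ) : ℂ) •
      (((N + M) + (t : ℂ) • (N - M)) * ((N + M) + (t : ℂ) • (N - M))ᴴ) := by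
    have h0 : (t : ℂ) ≠ 0 := by exact_mod_cast ht.ne'
    ext i j
    simp only [meanBound, Matrix.conjTranspose_sub, Matrix.conjTranspose_add,
      Matrix.conjTranspose_smul, Matrix.mul_add, Matrix.add_mul, Matrix.mul_sub, Matrix.sub_mul,
      Matrix.smul_mul, Matrix.mul_smul, Matrix.add_apply, Matrix.sub_apply, Matrix.smul_apply,
      smul_eq_mul, RCLike.star_def, Complex.conj_ofReal]
    push_cast
    field_simp
    ring
  rw [h]
  exact (Matrix.posSemidef_self_mul_conjTranspose _).smul (by exact_mod_cast (by positivity))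

lemma re_trace_meanBound (M N : Matrix ι κ ℂ) (t : ℝ) :
    (meanBound M N t).trace.re =
      t / 2 * ((N * Nᴴ).trace.re + (M * Mᴴ).trace.re - 2 * (M * Nᴴ).trace.re) +
      t⁻¹ / 2 * ((N * Nᴴ).trace.re + (M * Mᴴ).trace.re + 2 * (M * Nᴴ).trace.re) := by
  have h : (N * Mᴴ).trace.re = (M * Nᴴ).trace.re := by
    rw [← Matrix.conjTranspose_conjTranspose (N * Mᴴ), Matrix.trace_conjTranspose]
    simp
  simp only [meanBound, Matrix.conjTranspose_sub, Matrix.conjTranspose_add, Matrix.mul_add,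
    Matrix.add_mul, Matrix.mul_sub, Matrix.sub_mul, Matrix.trace_add, Matrix.trace_sub,
    Matrix.trace_smul, Complex.add_re, Complex.sub_re, smul_eq_mul, Complex.re_ofReal_mul, h]
  ring

end MeanBound

/-- The discriminant of `a t² - T t + b` covers `a = 0` and `b = 0`, where the optimal `t = √(b /
a)` is unavailable. -/
lemma le_two_mul_sqrt_of_forall_le {T a b : ℝ} (ha : 0 ≤ a) (hb : 0 ≤ b)
    (h : ∀ t : ℝ, 0 < t → T ≤ t * a + t⁻¹ * b) : T ≤ 2 * Real.sqrt (a * b) := by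
  rcases le_or_gt T 0 with hT | hT
  · exact hT.trans (by positivity)
  have hq (t : ℝ) : 0 ≤ a * (t * t) + -T * t + b := by
    rcases lt_or_ge 0 t with ht | ht
    · have h1 := mul_le_mul_of_nonneg_right (h t ht) ht.le
      have h2 : (t * a + t⁻¹ * b) * t = a * (t * t) + b := by field_simp
      linarith
    · have : 0 ≤ T * -t := mul_nonneg hT.le (by linarith)
      have : 0 ≤ a * (t * t) := mul_nonneg ha (mul_self_nonneg t)
      linarith
  have hd := discrim_le_zero hq
  rw [discrim] at hd
  have : T / 2 ≤ Real.sqrt (a * b) := Real.le_sqrt_of_sq_le (by nlinarith)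
  linarith

variable {d : ℕ}

/-! ### Choi matrices and pure inputs. -/

/-- The (unnormalized) Choi matrix of a linear map. -/
def choi (Δ : Matrix (Fin d) (Fin d) ℂ →ₗ[ℂ] Matrix (Fin d) (Fin d) ℂ) :
    Matrix (Fin d × Fin d) (Fin d × Fin d) ℂ :=
  Matrix.of fun p q ↦ Δ (Matrix.single p.1 q.1 1) p.2 q.2

/-- A nonnegative matrix over a matrix algebra is positive semidefinite when flattened. -/
lemma posSemidef_of_cstarMatrix_nonneg
    {N : CStarMatrix (Fin d) (Fin d) (Matrix (Fin d) (Fin d) ℂ)} (hN : 0 ≤ N) :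
    (Matrix.of fun p q : Fin d × Fin d ↦ N p.1 q.1 p.2 q.2).PosSemidef := by
  rw [StarOrderedRing.nonneg_iff] at hN
  -- Positive elements are generated by the `star c * c`, and flattening respects products and
  -- adjoints.
  induction hN using AddSubmonoid.closure_induction with
  | mem N hN =>
    obtain ⟨c, rfl⟩ := hN
    let C : Matrix (Fin d × Fin d) (Fin d × Fin d) ℂ := Matrix.of fun p q ↦ c p.1 q.1 p.2 q.2
    convert Matrix.posSemidef_conjTranspose_mul_self C using 1
    ext p q
    simp only [Matrix.of_apply, CStarMatrix.mul_apply]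
    simp [Matrix.sum_apply, Matrix.mul_apply, Fintype.sum_prod_type, CStarMatrix.star_apply, C]
  | zero => exact Matrix.PosSemidef.zero
  | add M N _ _ hM hN => exact hM.add hN

/-- The block matrix of matrix units `E_ij` is `star b * b`, where `b` has the single nonzero row
`E_0j`; complete positivity applies at level `d`. -/
lemma posSemidef_choi (hd : 1 ≤ d)
    (Λ : Matrix (Fin d) (Fin d) ℂ →CP Matrix (Fin d) (Fin d) ℂ) :
    (choi Λ.toLinearMap).PosSemidef := by
  let b : CStarMatrix (Fin d) (Fin d) (Matrix (Fin d) (Fin d) ℂ) :=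
    CStarMatrix.ofMatrix fun k j ↦ if k = ⟨0, hd⟩ then Matrix.single k j 1 else 0
  have hb (i j : Fin d) : (star b * b) i j = Matrix.single i j 1 := by
    have hb' (k j : Fin d) : b k j = if k = ⟨0, hd⟩ then Matrix.single k j 1 else 0 := rfl
    rw [CStarMatrix.mul_apply]
    simp [CStarMatrix.star_apply, hb', Matrix.star_eq_conjTranspose, apply_ite]
  have h := posSemidef_of_cstarMatrix_nonneg
    (Λ.map_cstarMatrix_nonneg' d (star b * b) (star_mul_self_nonneg b))
  simp only [CStarMatrix.map_apply, hb] at h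
  exact h

/-- The unnormalized maximally entangled vector. -/
def entangledVec (p : Fin d × Fin d) : ℂ := if p.1 = p.2 then 1 else 0

lemma choi_id : choi (d := d) LinearMap.id = Matrix.vecMulVec entangledVec (star entangledVec) := by
  ext p q
  by_cases h1 : p.1 = p.2 <;> by_cases h2 : q.1 = q.2 <;>
    simp [choi, Matrix.vecMulVec_apply, entangledVec, Matrix.single_apply, h1, h2]

lemma choi_sub (Δ₁ Δ₂ : Matrix (Fin d) (Fin d) ℂ →ₗ[ℂ] Matrix (Fin d) (Fin d) ℂ) :
    choi (Δ₁ - Δ₂) = choi Δ₁ - choi Δ₂ := rfl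

/-- The operator `A ⊗ 1` where the matrix `A` is the reshaped vector `ψ`. -/
def localOp (ψ : Fin d × Fin d → ℂ) : Matrix (Fin d × Fin d) (Fin d × Fin d) ℂ :=
  Matrix.of fun p q ↦ if p.2 = q.2 then ψ (p.1, q.1) else 0

lemma localOp_mul_apply {κ : Type*} (ψ : Fin d × Fin d → ℂ) (X : Matrix (Fin d × Fin d) κ ℂ)
    (p : Fin d × Fin d) (c : κ) : (localOp ψ * X) p c = ∑ i, ψ (p.1, i) * X (i, p.2) c := by
  simp [Matrix.mul_apply, localOp, Fintype.sum_prod_type]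

/-- The vector `ψ` is `(A ⊗ 1) Ω`, and `A ⊗ 1` acts on the reference only, so conjugation by it
commutes with `1 ⊗ Δ`. -/
lemma idTensor_pureState (Δ : Matrix (Fin d) (Fin d) ℂ →ₗ[ℂ] Matrix (Fin d) (Fin d) ℂ)
    (ψ : EuclideanSpace ℂ (Fin d × Fin d)) :
    idTensor Δ (pureState ψ) = localOp ψ * choi Δ * (localOp ψ)ᴴ := by
  ext p q
  have h : (Matrix.of fun i j ↦ pureState ψ (p.1, i) (q.1, j)) =
      ∑ i, ∑ j, (ψ (p.1, i) * star (ψ (q.1, j))) • Matrix.single i j (1 : ℂ) := by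
    conv_lhs => rw [Matrix.matrix_eq_sum_single (Matrix.of _)]
    simp [pureState, Matrix.vecMulVec_apply, Matrix.smul_single]
  rw [idTensor, Matrix.of_apply, h, Matrix.mul_assoc, localOp_mul_apply]
  simp only [map_sum, map_smul, Matrix.sum_apply, Matrix.smul_apply, smul_eq_mul]
  refine Finset.sum_congr rfl fun i _ ↦ ?_
  simp only [Matrix.mul_apply, Matrix.conjTranspose_apply, localOp, Matrix.of_apply, choi,
    Fintype.sum_prod_type, Finset.mul_sum]
  refine Finset.sum_congr rfl fun j _ ↦ ?_
  rw [Finset.sum_eq_single q.2]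
  · simp; ring
  · intro b _ hb; simp [hb.symm]
  · simp

/-- For `W = V V†` both traces are sums of squared entries; Cauchy–Schwarz bounds each entry of `(A
⊗ 1) V`, and the entries of `A` have square sum one. -/
lemma re_trace_localOp_conj_le (ψ : EuclideanSpace ℂ (Fin d × Fin d)) (hψ : ‖ψ‖ = 1)
    {W : Matrix (Fin d × Fin d) (Fin d × Fin d) ℂ} (hW : W.PosSemidef) :
    (localOp ψ * W * (localOp ψ)ᴴ).trace.re ≤ W.trace.re := by
  obtain ⟨V, rfl⟩ : ∃ V, W = V * Vᴴ := by
    obtain ⟨B, rfl⟩ := CStarAlgebra.nonneg_iff_eq_star_mul_self.1 hW.nonneg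
    exact ⟨Bᴴ, by rw [Matrix.conjTranspose_conjTranspose]; rfl⟩
  have h : localOp ψ * (V * Vᴴ) * (localOp ψ)ᴴ = (localOp ψ * V) * (localOp ψ * V)ᴴ := by
    simp only [Matrix.conjTranspose_mul, Matrix.mul_assoc]
  have hψ2 : ∑ a, ∑ i, ‖ψ (a, i)‖ ^ 2 = 1 := by
    rw [← Fintype.sum_prod_type (f := fun p ↦ ‖ψ p‖ ^ 2), ← EuclideanSpace.norm_sq_eq, hψ, one_pow]
  rw [h, re_trace_mul_conjTranspose, re_trace_mul_conjTranspose]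
  have hcs (p c : Fin d × Fin d) : ‖(localOp ψ * V) p c‖ ^ 2 ≤
      (∑ i, ‖ψ (p.1, i)‖ ^ 2) * ∑ i, ‖V (i, p.2) c‖ ^ 2 := by
    rw [localOp_mul_apply]
    refine le_trans ?_ (Finset.sum_mul_sq_le_sq_mul_sq _ _ _)
    gcongr
    exact (norm_sum_le _ _).trans_eq (by simp)
  refine (Finset.sum_le_sum fun p _ ↦ Finset.sum_le_sum fun c _ ↦ hcs p c).trans_eq ?_
  simp only [← Finset.mul_sum]
  rw [Fintype.sum_prod_type]
  simp only [← Finset.mul_sum, ← Finset.sum_mul]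
  rw [hψ2, one_mul, Fintype.sum_prod_type_right]
  exact Finset.sum_congr rfl fun b _ ↦ Finset.sum_comm

lemma traceNorm_localOp_conj_le (ψ : EuclideanSpace ℂ (Fin d × Fin d)) (hψ : ‖ψ‖ = 1)
    {X W : Matrix (Fin d × Fin d) (Fin d × Fin d) ℂ} (hX : X.IsHermitian) (hW : W.PosSemidef)
    (h₁ : (W - X).PosSemidef) (h₂ : (W + X).PosSemidef) :
    traceNorm (localOp ψ * X * (localOp ψ)ᴴ) ≤ W.trace.re := by
  refine (traceNorm_le_trace (Matrix.isHermitian_mul_mul_conjTranspose _ hX) ?_ ?_).trans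
    (re_trace_localOp_conj_le ψ hψ hW)
  · rw [← Matrix.sub_mul, ← Matrix.mul_sub]
    exact h₁.mul_mul_conjTranspose_same _
  · rw [← Matrix.add_mul, ← Matrix.mul_add]
    exact h₂.mul_mul_conjTranspose_same _

/-! ### The overlap and the upper bound. -/

/-- The overlap of the Choi matrix with the unnormalized maximally entangled vector. -/
def overlap (Λ : Matrix (Fin d) (Fin d) ℂ →ₗ[ℂ] Matrix (Fin d) (Fin d) ℂ) : ℂ :=
  ∑ i, ∑ j, Λ (Matrix.single i j 1) i j

lemma overlap_def (Λ : Matrix (Fin d) (Fin d) ℂ →ₗ[ℂ] Matrix (Fin d) (Fin d) ℂ) :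
    ∑ i, ∑ j, Λ (Matrix.single i j 1) i j = overlap Λ := rfl

lemma star_entangledVec : star (entangledVec (d := d)) = entangledVec := by
  ext p; simp [entangledVec]

lemma trace_choi (Λ : Matrix (Fin d) (Fin d) ℂ →ₗ[ℂ] Matrix (Fin d) (Fin d) ℂ)
    (hΛ : ∀ X : Matrix (Fin d) (Fin d) ℂ, (Λ X).trace = X.trace) :
    (choi Λ).trace = d := by
  have h : (choi Λ).trace = ∑ i, (Λ (Matrix.single i i 1)).trace := by
    simp [Matrix.trace, choi, Fintype.sum_prod_type]
  simp [h, hΛ]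

lemma trace_choi_mul_choi_id (Λ : Matrix (Fin d) (Fin d) ℂ →ₗ[ℂ] Matrix (Fin d) (Fin d) ℂ) :
    (choi LinearMap.id * choi Λ).trace = overlap Λ := by
  rw [choi_id, star_entangledVec]
  simp only [Matrix.trace, Matrix.diag_apply, Matrix.mul_apply, Matrix.vecMulVec_apply,
    entangledVec, Fintype.sum_prod_type, choi, Matrix.of_apply, overlap]
  simp
  exact Finset.sum_comm

/-- The mean fidelity in terms of the overlap. -/
lemma avgFidelity_eq_overlap
    (Λ : Matrix (Fin d) (Fin d) ℂ →ₗ[ℂ] Matrix (Fin d) (Fin d) ℂ)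
    (hΛ : ∀ X : Matrix (Fin d) (Fin d) ℂ, (Λ X).trace = X.trace) :
    avgFidelity Λ = (d + (overlap Λ).re) / (d * (d + 1)) := by
  rw [avgFidelity_eq]
  simp only [hΛ, Matrix.trace_single_eq_same, Finset.sum_const, Finset.card_univ,
    Fintype.card_fin, nsmul_eq_mul, mul_one, overlap_def]
  have h : ((d : ℂ) * (d + 1)) = ((d * (d + 1) : ℝ) : ℂ) := by push_cast; rfl
  rw [h, Complex.div_ofReal_re]
  simp

lemma exists_unit_smul_eq {ι : Type*} [Fintype ι] [Nonempty ι] (v : EuclideanSpace ℂ ι) :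
    ∃ η : EuclideanSpace ℂ ι, ‖η‖ = 1 ∧ v = (‖v‖ : ℂ) • η := by
  classical
  by_cases hv : v = 0
  · exact ⟨EuclideanSpace.single (Classical.arbitrary ι) 1, by simp, by simp [hv]⟩
  · have hn : (‖v‖ : ℂ) ≠ 0 := by simpa using hv
    exact ⟨(‖v‖ : ℂ)⁻¹ • v, by simp [norm_smul, hv], by rw [smul_inv_smul₀ hn]⟩

lemma star_dotProduct_self {ι : Type*} [Fintype ι] (v : EuclideanSpace ℂ ι) :
    star (v : ι → ℂ) ⬝ᵥ (v : ι → ℂ) = ((‖v‖ ^ 2 : ℝ) : ℂ) := by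
  rw [EuclideanSpace.norm_sq_eq]
  simp [dotProduct, Complex.conj_mul']

/-- A Choi matrix `K = M M†` and the maximally entangled projector `N N†`, factored so that
`Tr (M N†)` is the square root of their overlap. -/
lemma exists_factorization (hd : 1 ≤ d)
    (Λ : Matrix (Fin d) (Fin d) ℂ →ₗ[ℂ] Matrix (Fin d) (Fin d) ℂ) (hK : (choi Λ).PosSemidef) :
    ∃ (M N : Matrix (Fin d × Fin d) (Fin d × Fin d) ℂ) (s : ℝ), 0 ≤ s ∧ choi Λ = M * Mᴴ ∧
      choi LinearMap.id = N * Nᴴ ∧ (M * Nᴴ).trace = s ∧ overlap Λ = (s ^ 2 : ℝ) := by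
  have : Nonempty (Fin d × Fin d) := ⟨(⟨0, hd⟩, ⟨0, hd⟩)⟩
  obtain ⟨M, hM⟩ : ∃ M, choi Λ = M * Mᴴ := by
    obtain ⟨B, hB⟩ := CStarAlgebra.nonneg_iff_eq_star_mul_self.1 hK.nonneg
    exact ⟨Bᴴ, by rw [Matrix.conjTranspose_conjTranspose]; exact hB⟩
  let ω : Fin d × Fin d → ℂ := entangledVec
  -- Taking `N = |ω⟩⟨η|` with `η` along `M† ω` makes `Tr (M N†) = ‖M† ω‖`, the largest value over
  -- unit `η`. If `M† ω = 0`, any unit `η` serves.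
  let v : EuclideanSpace ℂ (Fin d × Fin d) := WithLp.toLp 2 (Mᴴ *ᵥ ω)
  obtain ⟨η, hη, hv⟩ := exists_unit_smul_eq v
  have hvf : Mᴴ *ᵥ ω = (‖v‖ : ℂ) • (η : Fin d × Fin d → ℂ) := congrArg WithLp.ofLp hv
  have hηη : star (η : Fin d × Fin d → ℂ) ⬝ᵥ (η : Fin d × Fin d → ℂ) = 1 := by
    rw [star_dotProduct_self, hη]; simp
  have hωM : star ω ᵥ* M = star (Mᴴ *ᵥ ω) := by
    rw [Matrix.star_mulVec, Matrix.conjTranspose_conjTranspose]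
  have hNH : (Matrix.vecMulVec ω (star (η : Fin d × Fin d → ℂ)))ᴴ =
      Matrix.vecMulVec (η : Fin d × Fin d → ℂ) (star ω) := by
    rw [Matrix.conjTranspose_vecMulVec, star_star]
  refine ⟨M, Matrix.vecMulVec ω (star (η : Fin d × Fin d → ℂ)), ‖v‖, norm_nonneg _, hM, ?_, ?_, ?_⟩
  · rw [hNH, choi_id, Matrix.vecMulVec_mul_vecMulVec, hηη, one_smul]
  · rw [hNH, Matrix.mul_vecMulVec, Matrix.trace_vecMulVec, dotProduct_comm,
      Matrix.dotProduct_mulVec, hωM, hvf, star_smul, smul_dotProduct, hηη]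
    simp
  · rw [← trace_choi_mul_choi_id, hM, choi_id, Matrix.vecMulVec_mul, Matrix.trace_vecMulVec,
      dotProduct_comm, ← Matrix.vecMul_vecMul]
    change star ω ᵥ* M ᵥ* Mᴴ ⬝ᵥ ω = _
    rw [← Matrix.dotProduct_mulVec, hωM]
    exact star_dotProduct_self v

lemma isHermitian_choi_sub_id
    (Λ : Matrix (Fin d) (Fin d) ℂ →ₗ[ℂ] Matrix (Fin d) (Fin d) ℂ) (hK : (choi Λ).PosSemidef) :
    (choi (Λ - LinearMap.id)).IsHermitian := by
  rw [choi_sub]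
  refine hK.isHermitian.sub ?_
  rw [choi_id]
  exact (Matrix.posSemidef_vecMulVec_self_star _).isHermitian

lemma trace_choi_id : (choi (d := d) LinearMap.id).trace = d :=
  trace_choi _ fun _ ↦ rfl

/-- For every input state the output of `Λ - 1` is controlled by the overlap. -/
lemma traceNorm_idTensor_le (hd : 1 ≤ d)
    (Λ : Matrix (Fin d) (Fin d) ℂ →ₗ[ℂ] Matrix (Fin d) (Fin d) ℂ) (hK : (choi Λ).PosSemidef)
    (hΛ : ∀ X : Matrix (Fin d) (Fin d) ℂ, (Λ X).trace = X.trace)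
    (ψ : EuclideanSpace ℂ (Fin d × Fin d)) (hψ : ‖ψ‖ = 1) :
    traceNorm (idTensor (Λ - LinearMap.id) (pureState ψ)) ≤
      2 * Real.sqrt (d ^ 2 - (overlap Λ).re) := by
  obtain ⟨M, N, s, hs, hM, hN, hMN, ho⟩ := exists_factorization hd Λ hK
  have hX : choi (Λ - LinearMap.id) = M * Mᴴ - N * Nᴴ := by rw [choi_sub, hM, hN]
  have htM : (M * Mᴴ).trace.re = d := by rw [← hM, trace_choi Λ hΛ]; simp
  have htN : (N * Nᴴ).trace.re = d := by rw [← hN, trace_choi_id]; simp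
  have hbound (t : ℝ) (ht : 0 < t) : traceNorm (idTensor (Λ - LinearMap.id) (pureState ψ)) ≤
      t * (d - s) + t⁻¹ * (d + s) := by
    rw [idTensor_pureState]
    refine (traceNorm_localOp_conj_le ψ hψ (isHermitian_choi_sub_id Λ hK)
      (posSemidef_meanBound M N ht) ?_ ?_).trans_eq ?_
    · rw [hX]; exact posSemidef_meanBound_sub M N ht
    · rw [hX]; exact posSemidef_meanBound_add M N ht
    · rw [re_trace_meanBound, htM, htN, hMN, Complex.ofReal_re]; ring
  -- `Tr (N - M)(N - M)† = 2 d - 2 s` is nonnegative.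
  have hsd : s ≤ d := by
    have h := re_trace_mul_conjTranspose (N - M)
    have h0 : 0 ≤ ((N - M) * (N - M)ᴴ).trace.re := by rw [h]; positivity
    have hc : (N * Mᴴ).trace.re = s := by
      rw [← Matrix.conjTranspose_conjTranspose (N * Mᴴ), Matrix.trace_conjTranspose]
      simp [hMN]
    simp only [Matrix.conjTranspose_sub, Matrix.mul_sub, Matrix.sub_mul, Matrix.trace_sub,
      Complex.sub_re, htM, htN, hMN, hc, Complex.ofReal_re] at h0
    linarith
  have hfin := le_two_mul_sqrt_of_forall_le (by linarith) (by positivity) hbound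
  rwa [ho, Complex.ofReal_re, show (d : ℝ) ^ 2 - s ^ 2 = (d - s) * (d + s) by ring]

/-! ### The lower bound from the maximally entangled input. -/

/-- The normalized maximally entangled state. -/
def maxEntangled (d : ℕ) : EuclideanSpace ℂ (Fin d × Fin d) :=
  ((Real.sqrt d)⁻¹ : ℂ) • WithLp.toLp 2 entangledVec

lemma inv_sqrt_mul_inv_sqrt : ((Real.sqrt d : ℂ)⁻¹) * ((Real.sqrt d : ℂ)⁻¹) = (d : ℂ)⁻¹ := by
  rw [← mul_inv, ← Complex.ofReal_mul, Real.mul_self_sqrt (by positivity), Complex.ofReal_natCast]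

lemma norm_maxEntangled (hd : 1 ≤ d) : ‖maxEntangled d‖ = 1 := by
  have h : ‖(WithLp.toLp 2 entangledVec : EuclideanSpace ℂ (Fin d × Fin d))‖ = Real.sqrt d := by
    rw [EuclideanSpace.norm_eq, Fintype.sum_prod_type]
    simp [entangledVec, apply_ite]
  have hd0 : Real.sqrt d ≠ 0 := by
    rw [Real.sqrt_ne_zero']; exact_mod_cast hd
  rw [maxEntangled, norm_smul, h, norm_inv, Complex.norm_real, Real.norm_eq_abs,
    abs_of_nonneg (Real.sqrt_nonneg _), inv_mul_cancel₀ hd0]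

lemma localOp_maxEntangled :
    localOp (maxEntangled d) = ((Real.sqrt d : ℂ)⁻¹) • (1 : Matrix (Fin d × Fin d) _ ℂ) := by
  ext ⟨a, p⟩ ⟨i, q⟩
  by_cases h1 : a = i <;> by_cases h2 : p = q <;>
    simp [localOp, maxEntangled, entangledVec, h1, h2]

lemma idTensor_maxEntangled (Δ : Matrix (Fin d) (Fin d) ℂ →ₗ[ℂ] Matrix (Fin d) (Fin d) ℂ) :
    idTensor Δ (pureState (maxEntangled d)) = ((d : ℂ)⁻¹) • choi Δ := by
  rw [idTensor_pureState, localOp_maxEntangled, Matrix.conjTranspose_smul,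
    Matrix.conjTranspose_one, Matrix.smul_mul, Matrix.one_mul, Matrix.mul_smul, Matrix.mul_one,
    smul_smul, ← inv_sqrt_mul_inv_sqrt]
  simp

/-- Since `⟨Ω|Ω⟩ = d`, the subtracted matrix is an orthogonal projection, and so is its complement.
-/
lemma posSemidef_one_sub_choi_id (hd : 1 ≤ d) :
    (1 - (d : ℂ)⁻¹ • choi (d := d) LinearMap.id).PosSemidef := by
  have hd0 : (d : ℂ) ≠ 0 := by exact_mod_cast (by omega : d ≠ 0)
  set P := (d : ℂ)⁻¹ • choi (d := d) LinearMap.id with hP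
  have hH : Pᴴ = P := by
    rw [hP, choi_id, Matrix.conjTranspose_smul, Matrix.conjTranspose_vecMulVec, star_star]
    simp
  have hω : star (entangledVec (d := d)) ⬝ᵥ entangledVec = d := by
    simp [dotProduct, Fintype.sum_prod_type, entangledVec]
  have hPP : P * P = P := by
    rw [hP, choi_id, Matrix.smul_mul, Matrix.mul_smul, Matrix.vecMulVec_mul_vecMulVec, hω,
      Matrix.vecMulVec_smul, smul_smul, smul_smul, mul_assoc, inv_mul_cancel₀ hd0, mul_one]
  have h : 1 - P = (1 - P) * (1 - P)ᴴ := by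
    rw [Matrix.conjTranspose_sub, hH, Matrix.conjTranspose_one]
    simp [Matrix.mul_sub, Matrix.sub_mul, hPP]
  rw [h]
  exact Matrix.posSemidef_self_mul_conjTranspose _

/-- The maximally entangled input detects the overlap. -/
lemma le_traceNorm_idTensor_maxEntangled (hd : 1 ≤ d)
    (Λ : Matrix (Fin d) (Fin d) ℂ →ₗ[ℂ] Matrix (Fin d) (Fin d) ℂ) (hK : (choi Λ).PosSemidef)
    (hΛ : ∀ X : Matrix (Fin d) (Fin d) ℂ, (Λ X).trace = X.trace) :
    2 * (1 - (overlap Λ).re / d ^ 2) ≤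
      traceNorm (idTensor (Λ - LinearMap.id) (pureState (maxEntangled d))) := by
  have hd0 : (d : ℝ) ≠ 0 := by exact_mod_cast (by omega : d ≠ 0)
  rw [idTensor_maxEntangled]
  set X := (d : ℂ)⁻¹ • choi (Λ - LinearMap.id) with hXdef
  set P := (d : ℂ)⁻¹ • choi (d := d) LinearMap.id with hPdef
  have hXh : X.IsHermitian := by
    rw [Matrix.IsHermitian, hXdef, Matrix.conjTranspose_smul, isHermitian_choi_sub_id Λ hK]
    simp
  have hid : (choi (d := d) LinearMap.id).PosSemidef := by
    rw [choi_id]; exact Matrix.posSemidef_vecMulVec_self_star _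
  have hinv : (0 : ℂ) ≤ (d : ℂ)⁻¹ := by simp
  have hXt : X.trace = 0 := by
    rw [hXdef, choi_sub, Matrix.trace_smul, Matrix.trace_sub, trace_choi Λ hΛ, trace_choi_id]
    simp
  -- The effect `1 - P` never fires on the output of the identity channel, and fires on that of `Λ`
  -- with probability `1 - G / d²`.
  have h := two_mul_re_trace_mul_le hXh hXt (P := 1 - P) (posSemidef_one_sub_choi_id hd)
    (by rw [sub_sub_cancel]; exact hid.smul hinv)
  refine le_trans (le_of_eq ?_) h
  have ho : overlap (d := d) LinearMap.id = d ^ 2 := by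
    simp [overlap, sq]
  rw [Matrix.sub_mul, Matrix.one_mul, Matrix.trace_sub, hXt, hPdef, hXdef, choi_sub,
    Matrix.smul_mul, Matrix.mul_smul, Matrix.mul_sub, Matrix.trace_smul, Matrix.trace_smul,
    Matrix.trace_sub, trace_choi_mul_choi_id, trace_choi_mul_choi_id, ho]
  have hr : (d : ℂ)⁻¹ = (((d : ℝ)⁻¹ : ℝ) : ℂ) := by push_cast; rfl
  have hr2 : (d : ℂ) ^ 2 = (((d : ℝ) ^ 2 : ℝ) : ℂ) := by push_cast; rfl
  rw [hr, hr2, smul_eq_mul, smul_eq_mul, Complex.sub_re, Complex.re_ofReal_mul,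
    Complex.re_ofReal_mul, Complex.sub_re, Complex.ofReal_re, Complex.zero_re]
  field_simp
  ring

end QuantumChannel

end

theorem mainTheorem7 (d : ℕ) (hd : 1 ≤ d)
    (Λ : Matrix (Fin d) (Fin d) ℂ →CP Matrix (Fin d) (Fin d) ℂ)
    (hΛ : ∀ X : Matrix (Fin d) (Fin d) ℂ, (Λ X).trace = X.trace)
    (r : ℝ) (hr : r = 1 - QuantumChannel.avgFidelity Λ.toLinearMap) :
    r * (d + 1) / d ≤ 1 / 2 * QuantumChannel.diamondNorm (Λ.toLinearMap - LinearMap.id) ∧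
      1 / 2 * QuantumChannel.diamondNorm (Λ.toLinearMap - LinearMap.id) ≤
        Real.sqrt (d * (d + 1) * r) := by
  have hK := QuantumChannel.posSemidef_choi hd Λ
  have hΛ' : ∀ X : Matrix (Fin d) (Fin d) ℂ, (Λ.toLinearMap X).trace = X.trace := hΛ
  have hd0 : (d : ℝ) ≠ 0 := by exact_mod_cast (by omega : d ≠ 0)
  have hd1 : (d + 1 : ℝ) ≠ 0 := by positivity
  rw [QuantumChannel.avgFidelity_eq_overlap _ hΛ'] at hr
  have hup := QuantumChannel.traceNorm_idTensor_le hd _ hK hΛ'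
  have hlow := QuantumChannel.le_traceNorm_idTensor_maxEntangled hd _ hK hΛ'
  set G := (QuantumChannel.overlap Λ.toLinearMap).re
  let ψ₀ : Metric.sphere (0 : EuclideanSpace ℂ (Fin d × Fin d)) 1 :=
    ⟨QuantumChannel.maxEntangled d, by simp [QuantumChannel.norm_maxEntangled hd]⟩
  have hup' (ψ : Metric.sphere (0 : EuclideanSpace ℂ (Fin d × Fin d)) 1) :=
    hup ψ.1 (by simp)
  -- A real supremum is only meaningful for a bounded family; the uniform upper bound supplies this
  -- for the lower estimate.
  have hbdd : BddAbove (Set.range fun ψ : Metric.sphere (0 : EuclideanSpace ℂ (Fin d × Fin d)) 1 ↦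
      QuantumChannel.traceNorm (QuantumChannel.idTensor (Λ.toLinearMap - LinearMap.id)
        (QuantumChannel.pureState ψ.1))) := ⟨_, Set.forall_mem_range.2 hup'⟩
  constructor
  · have h := hlow.trans (le_ciSup hbdd ψ₀)
    have he : r * (d + 1) / d = 1 - G / d ^ 2 := by
      rw [hr]; field_simp; ring
    rw [he, QuantumChannel.diamondNorm]
    linarith
  · have : Nonempty (Metric.sphere (0 : EuclideanSpace ℂ (Fin d × Fin d)) 1) := ⟨ψ₀⟩
    have h := ciSup_le hup'
    have he : d * (d + 1) * r = d ^ 2 - G := by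
      rw [hr]; field_simp; ring
    rw [he, QuantumChannel.diamondNorm]
    linarith
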